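/- **Theorem 4.** Let $C\subset\mathbb R^2$ be an axis-parallel rectangle ("cake") and let $1\le m\le n$. There are $n$ agents; agent $i$ has an integrable, non-negative and bounded value-density $v_i$ on $C$, and values a piece $A\subseteq C$ at $V_i(A)=\int_A v_i(x)\,dx$. Agents $1,\dots,m$ ("old" agents) currently hold pairwise-disjoint (up to boundaries) axis-parallel rectangles $Z_1,\dots,Z_m\subseteq C$, which need not cover $C$. A protocol knows $m,n,C,Z_1,\dots,Z_m$ and accesses the value measures only by queries, which the agents answer truthfully: an *eval* query asks an agent for its value of a given axis-parallel rectangle $R\subseteq C$; a *mark* query asks an agent to cut a given axis-parallel rectangle $R\subseteq C$ by a line parallel to a given axis so that the left (lower) part has a given value $a$, $0\le a\le V_i(R)$, for that agent. There is a universal constant $K$ such that for all such $m,n,C,Z_1,\dots,Z_m$ there is a protocol that, for all value-densities, after at most $K\,m\,n\log n$ queries, outputs pairwise-disjoint (up to boundaries) axis-parallel rectangles $X_1,\dots,X_n\subseteq C$ (not necessarily covering $C$), where agent $i$ receives $X_i$, such that 1. ($1/4$-proportionality) $V_i(X_i)\ge \frac{1}{4n}V_i(C)$ for every $i\in\{1,\dots,n\}$;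 2. (gradual retention) for every integer $k\in\{1,\dots,m\}$ there are at least $m-k$ indices $j\in\{1,\dots,m\}$ with $V_j(X_j)\ge \frac{1}{\lceil n/k\rceil}V_j(Z_j)$. -/

import Mathlib

namespace CakeRedivision

open MeasureTheory

/-- The plane. -/
abbrev Plane : Type := Fin 2 → ℝ

/-- An axis-parallel rectangle of positive width and height. As a set of points it is
`(a₀, b₀] × (a₁, b₁]`, so two rectangles that only share a part of their boundaries may be
disjoint; boundaries have zero value to all agents. -/
abbrev Rectangle : Type := BoxIntegral.Box (Fin 2)

/-- A value-density on the cake `C`: integrable, non-negative and bounded on `C`. -/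
structure IsValueDensity (C : Rectangle) (v : Plane → ℝ) : Prop where
  integrableOn : IntegrableOn v (C : Set Plane)
  nonneg : ∀ x ∈ C, 0 ≤ v x
  bounded : ∃ B : ℝ, ∀ x ∈ C, v x ≤ B

/-- The value of a piece to an agent with value-density `v`. -/
noncomputable def value (v : Plane → ℝ) (A : Set Plane) : ℝ :=
  ∫ x in A, v x

/-- A rectangular allocation of the cake `C` to `p` agents: one rectangle per agent, the rectangles
are contained in `C` and pairwise disjoint. Some of the cake may remain unallocated. -/
structure IsAllocation (C : Rectangle) {p : ℕ} (X : Fin p → Rectangle) : Prop where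
  subset : ∀ i, (X i : Set Plane) ⊆ (C : Set Plane)
  disjoint : ∀ i j, i ≠ j → Disjoint (X i : Set Plane) (X j : Set Plane)

/-- `r`-proportionality: each of the `n` agents gets at least `r / n` of its total cake value. -/
def IsProportional (r : ℝ) (C : Rectangle) {n : ℕ} (v : Fin n → Plane → ℝ)
    (X : Fin n → Rectangle) : Prop :=
  ∀ i, r / n * value (v i) C ≤ value (v i) (X i)

/-- Gradual retention. The old agents are the first `m` of the `n` agents. -/
def GradualRetention {m n : ℕ} (hmn : m ≤ n) (v : Fin n → Plane → ℝ)
    (Z : Fin m → Rectangle) (X : Fin n → Rectangle) : Prop :=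
  ∀ k : ℕ, 1 ≤ k → k ≤ m → ∃ J : Finset (Fin m), m - k ≤ J.card ∧ ∀ j ∈ J,
    1 / (⌈(n : ℝ) / k⌉₊ : ℝ) * value (v (Fin.castLE hmn j)) (Z j) ≤
      value (v (Fin.castLE hmn j)) (X (Fin.castLE hmn j))

/-- The part of the rectangle `R` on the lower side of the line on which coordinate `d` is `t`. -/
def lowerPart (R : Rectangle) (d : Fin 2) (t : ℝ) : Set Plane :=
  {x | x ∈ R ∧ x d ≤ t}

/-- A deterministic query protocol for `n` agents with outputs in `β`: a tree that at each internal
node asks one agent one query and continues according to the (real) answer.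
* `eval i R next`: agent `i` reveals its value for `R`;
* `mark i R d a next`: agent `i` cuts `R` at some coordinate `t` of the axis `d` so that the lower
  part of `R` has value `a`, and reveals `t`. -/
inductive Protocol (n : ℕ) (β : Type) : Type
  | done (out : β) : Protocol n β
  | eval (i : Fin n) (R : Rectangle) (next : ℝ → Protocol n β) : Protocol n β
  | mark (i : Fin n) (R : Rectangle) (d : Fin 2) (a : ℝ) (next : ℝ → Protocol n β) : Protocol n β

/-- `P.Achieves C v Good q`: when the agents have the value-densities `v` and answer truthfully,
the protocol `P` on the cake `C` stops after at most `q` queries with an output that is `Good`,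
whichever truthful answer is given where a mark query has several ones. Only legal queries may be
asked: they concern rectangles inside the cake, and the value asked for in a mark query lies between
zero and the value of the rectangle (so that a truthful answer exists). -/
def Protocol.Achieves {n : ℕ} {β : Type} (C : Rectangle) (v : Fin n → Plane → ℝ)
    (Good : β → Prop) : Protocol n β → ℕ → Prop
  | .done out, _ => Good out
  | .eval _ _ _, 0 => False
  | .eval i R next, q + 1 =>
      (R : Set Plane) ⊆ (C : Set Plane) ∧
      Protocol.Achieves C v Good (next (value (v i) R)) q
  | .mark _ _ _ _ _, 0 => False
  | .mark i R d a next, q + 1 =>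
      (R : Set Plane) ⊆ (C : Set Plane) ∧ 0 ≤ a ∧ a ≤ value (v i) R ∧
      ∀ t ∈ Set.Icc (R.lower d) (R.upper d), value (v i) (lowerPart R d t) = a →
        Protocol.Achieves C v Good (next t) q

end CakeRedivision

/-! The rectangles `Z j` extend to a partition of `C` into at most `3m + 1` rectangles, with
distinct `Z j` in distinct pieces (`exists_partition`). All agents evaluate all pieces, are
distributed among them (`exists_assignment`), and each piece is divided proportionally among its
agents by halving (`solvable_isDivision`).

For the distribution, agent `i` has on each piece a quota, the floor of `4n` times the piece's share
of its cake value. Rounding loses less than one per piece, so the quotas of an agent sum to at least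
`n`, and a stable assignment exists in which no piece holds more agents than the quota of any agent
in it. Proportional division then gives everyone at least `1 / (4n)` of its value of `C`.

Stability also concerns the piece around `Z j`, the home of old agent `j`. Let `N j` agents be
there. If `j` is among them, it gets at least `1 / N j` of its home. Otherwise its quota at home is
at most `N j`, so its home is worth at most `(N j + 1) / (4n)` of the cake, and its proportional
share is already `1 / (N j + 1)` of its home. Since the `N j` sum to at most `n`, at most `k` of
them reach `⌈n / k⌉`, which is gradual retention.

The cost is one evaluation per agent and piece, plus `O(n log n)` queries for the divisions. -/

namespace CakeRedivision

open MeasureTheory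

/-! ### Stable assignment of agents to pieces -/

section Assignment

variable {κ ι : Type} [Fintype κ]

/-- The total quota of a partial assignment. -/
def quota (q : κ → ι → ℕ) (σ : κ → Option ι) : ℕ :=
  ∑ i, (σ i).elim 0 (q i)

lemma quota_update [DecidableEq κ] (q : κ → ι → ℕ) (σ : κ → Option ι) (i : κ) (o : Option ι) :
    quota q (Function.update σ i o) + (σ i).elim 0 (q i) = quota q σ + o.elim 0 (q i) := by
  unfold quota
  rw [← Finset.add_sum_erase _ _ (Finset.mem_univ i),
    ← Finset.add_sum_erase Finset.univ (fun i => (σ i).elim 0 (q i)) (Finset.mem_univ i)]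
  have : ∑ x ∈ Finset.univ.erase i, (Function.update σ i o x).elim 0 (q x) =
      ∑ x ∈ Finset.univ.erase i, (σ x).elim 0 (q x) := by
    refine Finset.sum_congr rfl fun x hx => ?_
    rw [Function.update_of_ne (Finset.ne_of_mem_erase hx)]
  rw [this, Function.update_self]
  ring

variable [DecidableEq ι]

/-- The number of agents that a partial assignment `σ` sends to the piece `j`. -/
def load (σ : κ → Option ι) (j : ι) : ℕ := (Finset.univ.filter fun i => σ i = some j).card

/-- A partial assignment in which no piece is overloaded from the point of view of the agents
assigned to it, and in which agents are sent away from home only if their home is saturated. -/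
def IsStable (q : κ → ι → ℕ) (home : κ → Option ι) (σ : κ → Option ι) : Prop :=
  (∀ i j, σ i = some j → load σ j ≤ q i j) ∧
    ∀ i j k, σ i = some j → home i = some k → j = k ∨ q i k ≤ load σ k

lemma sum_load_le (σ : κ → Option ι) (s : Finset ι) : ∑ j ∈ s, load σ j ≤ Fintype.card κ := by
  classical
  unfold load
  rw [← Finset.card_biUnion]
  · exact Finset.card_le_univ _
  · intro a _ b _ hab
    rw [Function.onFun, Finset.disjoint_left]
    intro i hi hi'
    simp only [Finset.mem_filter, Finset.mem_univ, true_and] at hi hi'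
    rw [hi] at hi'
    exact hab (Option.some_injective _ hi')

variable [DecidableEq κ]

lemma load_update_of_ne (σ : κ → Option ι) {i : κ} (hi : σ i = none) {j k : ι} (hjk : k ≠ j) :
    load (Function.update σ i (some j)) k = load σ k := by
  unfold load
  congr 1
  ext x
  simp only [Finset.mem_filter, Finset.mem_univ, true_and, Function.update_apply]
  split_ifs with h
  · subst h; simp [hi, Ne.symm hjk]
  · rfl

lemma load_update_self (σ : κ → Option ι) {i : κ} (hi : σ i = none) (j : ι) :
    load (Function.update σ i (some j)) j = load σ j + 1 := by
  unfold load
  rw [← Finset.card_insert_of_notMem (a := i) (by simp [hi])]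
  congr 1
  ext x
  simp only [Finset.mem_filter, Finset.mem_univ, true_and, Function.update_apply,
    Finset.mem_insert]
  split_ifs with h <;> simp [h]

lemma load_update_none_of_ne (σ : κ → Option ι) {i : κ} {j k : ι} (hi : σ i = some j)
    (hjk : k ≠ j) : load (Function.update σ i none) k = load σ k := by
  unfold load
  congr 1
  ext x
  simp only [Finset.mem_filter, Finset.mem_univ, true_and, Function.update_apply]
  split_ifs with h
  · subst h; simp [hi, Ne.symm hjk]
  · rfl

lemma load_update_none (σ : κ → Option ι) {i : κ} {j : ι} (hi : σ i = some j) :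
    load (Function.update σ i none) j + 1 = load σ j := by
  have h := load_update_self (Function.update σ i none) (i := i) (by simp) j
  rw [Function.update_idem, ← hi, Function.update_eq_self] at h
  exact h.symm

variable [Fintype ι]

lemma sum_load_lt (σ : κ → Option ι) {i : κ} (hi : σ i = none) :
    ∑ j, load σ j < Fintype.card κ := by
  unfold load
  rw [← Finset.card_biUnion]
  · apply Finset.card_lt_univ_of_notMem (x := i)
    simp [hi]
  · intro a _ b _ hab
    rw [Function.onFun, Finset.disjoint_left]
    intro i hi hi'
    simp only [Finset.mem_filter, Finset.mem_univ, true_and] at hi hi'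
    rw [hi] at hi'
    exact hab (Option.some_injective _ hi')

/-- If an agent is unassigned by a stable partial assignment then the total quota can be
increased: the agent joins a piece that is not saturated for it, replacing an agent for whom this
piece would become overloaded. -/
lemma IsStable.exists_quota_lt {q : κ → ι → ℕ} {home : κ → Option ι} {σ : κ → Option ι}
    (hσ : IsStable q home σ) (hq : ∀ i, Fintype.card κ ≤ ∑ j, q i j) {i : κ} (hi : σ i = none) :
    ∃ τ, IsStable q home τ ∧ quota q σ < quota q τ := by
  -- Some piece is unsaturated for `i`, since the loads sum to less than the quotas of `i`. The home
  -- is taken if it is unsaturated; any other choice then leaves a saturated home.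
  obtain ⟨j, hj, hhome⟩ : ∃ j, load σ j < q i j ∧
      ∀ k, home i = some k → j = k ∨ q i k ≤ load σ k := by
    obtain ⟨j, -, hj⟩ := Finset.exists_lt_of_sum_lt ((sum_load_lt σ hi).trans_le (hq i))
    by_cases hk : ∃ k, home i = some k ∧ load σ k < q i k
    · obtain ⟨k, hk, hlt⟩ := hk
      refine ⟨k, hlt, fun k' hk' => Or.inl ?_⟩
      rw [hk] at hk'
      exact Option.some_injective _ hk'
    · push Not at hk
      exact ⟨j, hj, fun k h => Or.inr (hk k h)⟩
  -- If adding `i` would overload `j` for some `x`, then `i` replaces `x`: loads do not change, and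
  -- the quota grows because `q x j = load σ j < q i j`.
  by_cases hfull : ∃ x, σ x = some j ∧ q x j = load σ j
  · obtain ⟨x, hx, hxq⟩ := hfull
    have hix : i ≠ x := by rintro rfl; simp [hi] at hx
    have hi' : Function.update σ x none i = none := by rw [Function.update_of_ne hix, hi]
    have hload : ∀ k, load (Function.update (Function.update σ x none) i (some j)) k
        = load σ k := by
      intro k
      by_cases hk : k = j
      · subst hk
        rw [load_update_self _ hi', load_update_none _ hx]
      · rw [load_update_of_ne _ hi' hk, load_update_none_of_ne _ hx hk]
    refine ⟨Function.update (Function.update σ x none) i (some j), ⟨?_, ?_⟩, ?_⟩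
    · intro y k hy
      rw [hload]
      by_cases hyi : y = i
      · subst hyi
        rw [Function.update_self] at hy
        obtain rfl := Option.some_injective _ hy
        exact hj.le
      · rw [Function.update_of_ne hyi] at hy
        by_cases hyx : y = x
        · subst hyx; simp at hy
        · rw [Function.update_of_ne hyx] at hy
          exact hσ.1 y k hy
    · intro y k l hy hl
      rw [hload]
      by_cases hyi : y = i
      · subst hyi
        rw [Function.update_self] at hy
        obtain rfl := Option.some_injective _ hy
        exact hhome l hl
      · rw [Function.update_of_ne hyi] at hy
        by_cases hyx : y = x
        · subst hyx; simp at hy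
        · rw [Function.update_of_ne hyx] at hy
          exact hσ.2 y k l hy hl
    · have h1 := quota_update q σ x none
      have h2 := quota_update q (Function.update σ x none) i (some j)
      rw [hi'] at h2
      rw [hx] at h1
      simp only [Option.elim_none, Option.elim_some] at h1 h2
      omega
  · push Not at hfull
    refine ⟨Function.update σ i (some j), ⟨?_, ?_⟩, ?_⟩
    · intro y k hy
      by_cases hyi : y = i
      · subst hyi
        rw [Function.update_self] at hy
        obtain rfl := Option.some_injective _ hy
        rw [load_update_self _ hi]
        exact hj
      · rw [Function.update_of_ne hyi] at hy
        by_cases hk : k = j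
        · subst hk
          rw [load_update_self _ hi]
          exact lt_of_le_of_ne (hσ.1 y k hy) (Ne.symm (hfull y hy))
        · rw [load_update_of_ne _ hi hk]
          exact hσ.1 y k hy
    · intro y k l hy hl
      -- Loads only grow, so saturated homes stay saturated.
      have hle : load σ l ≤ load (Function.update σ i (some j)) l := by
        by_cases hlj : l = j
        · subst hlj
          rw [load_update_self _ hi]
          omega
        · rw [load_update_of_ne _ hi hlj]
      by_cases hyi : y = i
      · subst hyi
        rw [Function.update_self] at hy
        obtain rfl := Option.some_injective _ hy
        exact (hhome l hl).imp_right fun h => h.trans hle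
      · rw [Function.update_of_ne hyi] at hy
        exact (hσ.2 y k l hy hl).imp_right fun h => h.trans hle
    · have h1 := quota_update q σ i (some j)
      rw [hi] at h1
      simp only [Option.elim_none, Option.elim_some] at h1
      omega

/-- Agents with enough quota can all be assigned in a stable way. -/
lemma exists_isStable_total (q : κ → ι → ℕ) (home : κ → Option ι)
    (hq : ∀ i, Fintype.card κ ≤ ∑ j, q i j) :
    ∃ σ : κ → ι, IsStable q home fun i => some (σ i) := by
  classical
  have hne : (Finset.univ.filter fun σ => IsStable q home σ).Nonempty :=
    ⟨fun _ => none, Finset.mem_filter.2 ⟨Finset.mem_univ _, by simp [IsStable]⟩⟩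
  obtain ⟨σ, hσ, hmax⟩ := Finset.exists_max_image _ (quota q) hne
  simp only [Finset.mem_filter, Finset.mem_univ, true_and] at hσ hmax
  have htot : ∀ i, ∃ j, σ i = some j := by
    intro i
    rw [← Option.ne_none_iff_exists']
    intro hi
    obtain ⟨τ, hτ, hlt⟩ := hσ.exists_quota_lt hq hi
    exact (hmax τ hτ).not_gt hlt
  choose τ hτ using htot
  refine ⟨τ, ?_⟩
  rwa [← funext hτ]

/-- The agents can be assigned to the pieces so that each agent `i` gets into a piece whose value,
divided by the number of agents in it, is at least `1 / N` of the total, and each agent is at home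
unless its home is worth to it at most `1 / N` of the total for each agent there and one more. -/
lemma exists_assignment (w : κ → ι → ℝ) (hw : ∀ i j, 0 ≤ w i j) (home : κ → Option ι) (N : ℕ)
    [Nonempty ι] (hN : Fintype.card κ + Fintype.card ι ≤ N + 1) :
    ∃ σ : κ → ι,
      (∀ i, (load (fun i => some (σ i)) (σ i) : ℝ) * ∑ j, w i j ≤ N * w i (σ i)) ∧
      ∀ i j, home i = some j → σ i = j ∨
        N * w i j ≤ (load (fun i => some (σ i)) j + 1) * ∑ j, w i j := by
  classical
  -- An agent with total value zero is content anywhere; its quota must still be large enough for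
  -- `hq`, which the floor of a division by zero is not.
  set q : κ → ι → ℕ := fun i j =>
    if ∑ j, w i j = 0 then Fintype.card κ else ⌊N * w i j / ∑ j, w i j⌋₊ with hqdef
  have hW : ∀ i, 0 ≤ ∑ j, w i j := fun i => Finset.sum_nonneg fun j _ => hw i j
  have hq : ∀ i, Fintype.card κ ≤ ∑ j, q i j := by
    intro i
    by_cases h0 : ∑ j, w i j = 0
    · simp only [hqdef, h0, if_true, Finset.sum_const, Finset.card_univ, smul_eq_mul]
      exact Nat.le_mul_of_pos_left _ Fintype.card_pos
    -- The strict bound for the floor accounts for the `+ 1` in `hN`.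
    · have hlt : (N : ℝ) < ∑ j, ((q i j : ℝ) + 1) := by
        have : (N : ℝ) = ∑ j, N * w i j / ∑ j, w i j := by
          rw [← Finset.sum_div, ← Finset.mul_sum, mul_div_assoc, div_self h0, mul_one]
        rw [this]
        refine Finset.sum_lt_sum_of_nonempty Finset.univ_nonempty fun j _ => ?_
        simp only [hqdef, h0, if_false]
        exact Nat.lt_floor_add_one _
      rw [Finset.sum_add_distrib] at hlt
      simp only [Finset.sum_const, Finset.card_univ, nsmul_eq_mul, mul_one] at hlt
      have : N < ∑ j, q i j + Fintype.card ι := by exact_mod_cast hlt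
      omega
  obtain ⟨σ, h1, h2⟩ := exists_isStable_total q home hq
  refine ⟨σ, fun i => ?_, fun i j hij => ?_⟩
  · by_cases h0 : ∑ j, w i j = 0
    · rw [h0, mul_zero]
      exact mul_nonneg (Nat.cast_nonneg _) (hw _ _)
    · have hpos : 0 < ∑ j, w i j := lt_of_le_of_ne (hW i) (Ne.symm h0)
      have h := h1 i (σ i) rfl
      simp only [hqdef, h0, if_false] at h
      rw [← le_div_iff₀ hpos]
      exact (Nat.cast_le.2 h).trans (Nat.floor_le (by have := hw i (σ i); positivity))
  · refine (h2 i (σ i) j rfl hij).imp_right fun h => ?_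
    by_cases h0 : ∑ j, w i j = 0
    · rw [h0, (Finset.sum_eq_zero_iff_of_nonneg fun j _ => hw i j).1 h0 j (Finset.mem_univ j)]
      simp
    · have hpos : 0 < ∑ j, w i j := lt_of_le_of_ne (hW i) (Ne.symm h0)
      simp only [hqdef, h0, if_false] at h
      rw [← div_le_iff₀ hpos]
      exact (Nat.lt_floor_add_one _).le.trans (by gcongr)

end Assignment

/-! ### Extending disjoint rectangles to a partition of the cake -/

section Partition

/-- The half-open rectangle with the given corners; it may be empty. -/
def corners (l u : Plane) : Set Plane := {x | ∀ d, l d < x d ∧ x d ≤ u d}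

lemma mem_corners {l u x : Plane} :
    x ∈ corners l u ↔ (l 0 < x 0 ∧ x 0 ≤ u 0) ∧ l 1 < x 1 ∧ x 1 ≤ u 1 := by
  simp [corners, Fin.forall_fin_two]

lemma coe_rectangle (R : Rectangle) : (R : Set Plane) = corners R.lower R.upper := by
  ext x; simp [corners, BoxIntegral.Box.mem_def]

/-- The state of a sweep of the cake `C` in direction of the axis `0` that has met the rectangles
`Z j` with `j ∈ s`: a partition of `C` into rectangles with corners `l t` and `u t`. The rectangle
of each `Z j` extends it along the axis `0` only, and rectangles end at the end of `C` or where
the sweep has met some `Z j`. -/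
structure IsSweep {κ ι : Type} (C : Rectangle) (Z : κ → Rectangle) (s : Finset κ)
    (l u : ι → Plane) (h : κ → ι) : Prop where
  injOn : Set.InjOn h s
  subset : ∀ t, corners (l t) (u t) ⊆ C
  disjoint : ∀ t t' x, x ∈ corners (l t) (u t) → x ∈ corners (l t') (u t') → t = t'
  cover : ∀ x ∈ C, ∃ t, x ∈ corners (l t) (u t)
  ends : ∀ t, u t 0 = C.upper 0 ∨ ∃ j ∈ s, u t 0 ≤ (Z j).lower 0
  home_lower : ∀ j ∈ s, l (h j) 0 ≤ (Z j).lower 0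
  home_upper : ∀ j ∈ s, (Z j).upper 0 ≤ u (h j) 0
  home_lower_one : ∀ j ∈ s, l (h j) 1 = (Z j).lower 1
  home_upper_one : ∀ j ∈ s, u (h j) 1 = (Z j).upper 1

variable {κ ι : Type} {C : Rectangle} {Z : κ → Rectangle}

/-- A piece that stops before the end of `C` stops no later than the lower edge of some `Z k`
already met, hence not beyond the sweep line. -/
lemma IsSweep.upper_eq_of_meets {s : Finset κ} {l u : ι → Plane} {h : κ → ι}
    (H : IsSweep C Z s l u h) {j : κ} (hj : ∀ k ∈ s, (Z k).lower 0 ≤ (Z j).lower 0) {t : ι}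
    {x : Plane} (hx : x ∈ corners (l t) (u t)) (hxj : (Z j).lower 0 < x 0) :
    u t 0 = C.upper 0 := by
  rcases H.ends t with h0 | ⟨k, hk, hle⟩
  · exact h0
  · have h1 := hj k hk
    have h2 := (mem_corners.1 hx).1.2
    linarith

/-- At most one rectangle of a sweep crosses, beyond the sweep line, the line on which the
coordinate `1` is `y`. -/
lemma IsSweep.eq_of_cross {s : Finset κ} {l u : ι → Plane} {h : κ → ι}
    (H : IsSweep C Z s l u h) {j : κ} (hj : ∀ k ∈ s, (Z k).lower 0 ≤ (Z j).lower 0) {t t' : ι}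
    {x x' : Plane} (hx : x ∈ corners (l t) (u t)) (hxj : (Z j).lower 0 < x 0)
    (hx' : x' ∈ corners (l t') (u t')) (hxj' : (Z j).lower 0 < x' 0) {y : ℝ}
    (ht : l t 1 < y ∧ y ≤ u t 1) (ht' : l t' 1 < y ∧ y ≤ u t' 1) : t = t' := by
  have e := H.upper_eq_of_meets hj hx hxj
  have e' := H.upper_eq_of_meets hj hx' hxj'
  rw [mem_corners] at hx hx'
  -- Both pieces reach the end of `C`, so they share the point of that edge at height `y`.
  refine H.disjoint t t' ![C.upper 0, y] (mem_corners.2 ?_) (mem_corners.2 ?_)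
  · simp only [Matrix.cons_val_zero, Matrix.cons_val_one, e]
    exact ⟨⟨by linarith, le_rfl⟩, ht⟩
  · simp only [Matrix.cons_val_zero, Matrix.cons_val_one, e']
    exact ⟨⟨by linarith, le_rfl⟩, ht'⟩

/-- `Z j` is extended to the end of `C`, and all pieces that this strip meets are cut off at the
sweep line. Beyond the line, what they leave outside the strip is at most one rectangle above and
one below, by `IsSweep.eq_of_cross`. Hence three new pieces suffice, however many are cut. -/
lemma IsSweep.insert [DecidableEq κ] {s : Finset κ} {l u : ι → Plane} {h : κ → ι}
    (H : IsSweep C Z s l u h)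
    (hsub : ∀ j, (Z j : Set Plane) ⊆ C)
    (hdis : ∀ i j, i ≠ j → Disjoint (Z i : Set Plane) (Z j : Set Plane)) {j : κ} (hjs : j ∉ s)
    (hj : ∀ k ∈ s, (Z k).lower 0 ≤ (Z j).lower 0) :
    ∃ (l' u' : ι ⊕ Fin 3 → Plane) (h' : κ → ι ⊕ Fin 3),
      IsSweep C Z (insert j s) l' u' h' := by
  classical
  set a := (Z j).lower 0
  set c := (Z j).lower 1
  set d := (Z j).upper 1
  have hab : a < (Z j).upper 0 := (Z j).lower_lt_upper 0
  have hcd : c < d := (Z j).lower_lt_upper 1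
  have hC : C.lower 0 ≤ a ∧ (Z j).upper 0 ≤ C.upper 0 ∧ C.lower 1 ≤ c ∧ d ≤ C.upper 1 := by
    have hle : Z j ≤ C := hsub j
    rw [BoxIntegral.Box.le_iff_bounds] at hle
    exact ⟨hle.1 0, hle.2 0, hle.1 1, hle.2 1⟩
  -- a rectangle meets the extension of `Z j` to the end of `C`
  set M : ι → Prop := fun t => ∃ x ∈ corners (l t) (u t), a < x 0 ∧ c < x 1 ∧ x 1 ≤ d with hM
  have hMu : ∀ {t}, M t → u t 0 = C.upper 0 := fun ⟨x, hx, hxa, _⟩ =>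
    H.upper_eq_of_meets hj hx hxa
  -- the rectangle above `Z j` and the rectangle below
  obtain ⟨lT, uT, hT, hT', hTu⟩ : ∃ lT uT : Plane,
      (∀ x ∈ corners lT uT, ∃ t, M t ∧ x ∈ corners (l t) (u t) ∧ a < x 0 ∧ d < x 1) ∧
      (∀ t, M t → ∀ x ∈ corners (l t) (u t), a < x 0 → d < x 1 → x ∈ corners lT uT) ∧
      uT 0 = C.upper 0 := by
    by_cases hex : ∃ t, M t ∧ d < u t 1
    · obtain ⟨t, hMt, hdt⟩ := hex
      obtain ⟨y, hy, hya, -, hyd⟩ := id hMt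
      have hy' := mem_corners.1 hy
      -- `IsSweep` does not record that pieces start at or before the sweep line, hence the maximum.
      refine ⟨![max a (l t 0), d], ![C.upper 0, u t 1], fun x hx => ?_,
        fun t' hMt' x hx hxa hxd => ?_, rfl⟩
      · rw [mem_corners] at hx
        simp only [Matrix.cons_val_zero, Matrix.cons_val_one, max_lt_iff] at hx
        refine ⟨t, hMt, mem_corners.2 ⟨⟨hx.1.1.2, ?_⟩, by linarith, hx.2.2⟩, hx.1.1.1, hx.2.1⟩
        rw [hMu hMt]
        exact hx.1.2
      · obtain ⟨z, hz, hza, -, hzd⟩ := id hMt'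
        have hz' := mem_corners.1 hz
        have hx' := mem_corners.1 hx
        obtain rfl : t = t' := H.eq_of_cross hj hy hya hz hza (y := d)
          ⟨by linarith, hdt.le⟩ ⟨by linarith, by linarith⟩
        rw [mem_corners]
        simp only [Matrix.cons_val_zero, Matrix.cons_val_one, max_lt_iff]
        exact ⟨⟨⟨hxa, hx'.1.1⟩, hMu hMt ▸ hx'.1.2⟩, hxd, hx'.2.2⟩
    · push Not at hex
      -- Nothing remains above: an empty rectangle is used, placed so that `ends` still holds.
      refine ⟨C.upper, C.upper, fun x hx => ?_, fun t hMt x hx _ hxd => ?_, rfl⟩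
      · exact ((mem_corners.1 hx).1.1.not_ge (mem_corners.1 hx).1.2).elim
      · exact (((mem_corners.1 hx).2.2.trans (hex t hMt)).not_gt hxd).elim
  obtain ⟨lB, uB, hB, hB', hBu⟩ : ∃ lB uB : Plane,
      (∀ x ∈ corners lB uB, ∃ t, M t ∧ x ∈ corners (l t) (u t) ∧ a < x 0 ∧ x 1 ≤ c) ∧
      (∀ t, M t → ∀ x ∈ corners (l t) (u t), a < x 0 → x 1 ≤ c → x ∈ corners lB uB) ∧
      uB 0 = C.upper 0 := by
    by_cases hex : ∃ t, M t ∧ l t 1 < c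
    · obtain ⟨t, hMt, hct⟩ := hex
      obtain ⟨y, hy, hya, hyc, -⟩ := id hMt
      have hy' := mem_corners.1 hy
      refine ⟨![max a (l t 0), l t 1], ![C.upper 0, c], fun x hx => ?_,
        fun t' hMt' x hx hxa hxc => ?_, rfl⟩
      · rw [mem_corners] at hx
        simp only [Matrix.cons_val_zero, Matrix.cons_val_one, max_lt_iff] at hx
        refine ⟨t, hMt, mem_corners.2 ⟨⟨hx.1.1.2, ?_⟩, hx.2.1, by linarith⟩, hx.1.1.1, hx.2.2⟩
        rw [hMu hMt]
        exact hx.1.2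
      · obtain ⟨z, hz, hza, hzc, -⟩ := id hMt'
        have hz' := mem_corners.1 hz
        have hx' := mem_corners.1 hx
        obtain rfl : t = t' := H.eq_of_cross hj hy hya hz hza (y := c)
          ⟨hct, by linarith⟩ ⟨by linarith, by linarith⟩
        rw [mem_corners]
        simp only [Matrix.cons_val_zero, Matrix.cons_val_one, max_lt_iff]
        exact ⟨⟨⟨hxa, hx'.1.1⟩, hMu hMt ▸ hx'.1.2⟩, hx'.2.1, hxc⟩
    · push Not at hex
      refine ⟨C.upper, C.upper, fun x hx => ?_, fun t hMt x hx _ hxc => ?_, rfl⟩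
      · exact ((mem_corners.1 hx).1.1.not_ge (mem_corners.1 hx).1.2).elim
      · exact (((hex t hMt).trans_lt (mem_corners.1 hx).2.1).not_ge hxc).elim
  set L : Fin 3 → Plane := ![(Z j).lower, lT, lB]
  set U : Fin 3 → Plane := ![![C.upper 0, d], uT, uB]
  set u₁ : ι → Plane := fun t => if M t then ![min (u t 0) a, u t 1] else u t with hu₁
  have hmem : ∀ t x, x ∈ corners (l t) (u₁ t) ↔
      x ∈ corners (l t) (u t) ∧ (M t → x 0 ≤ a) := by
    intro t x
    by_cases h : M t
    · simp only [hu₁, h, if_true, mem_corners, Matrix.cons_val_zero, Matrix.cons_val_one,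
        le_min_iff, forall_const]
      tauto
    · simp [hu₁, h]
  have hmem0 : ∀ x, x ∈ corners (L 0) (U 0) ↔
      (a < x 0 ∧ x 0 ≤ C.upper 0) ∧ c < x 1 ∧ x 1 ≤ d := fun x => mem_corners
  have hnew : ∀ r x, x ∈ corners (L r) (U r) →
      a < x 0 ∧ ∀ t, x ∈ corners (l t) (u t) → M t := by
    intro r x hx
    fin_cases r
    · rw [Fin.mk_zero, hmem0] at hx
      exact ⟨hx.1.1, fun t ht => ⟨x, ht, hx.1.1, hx.2⟩⟩
    · obtain ⟨t, hMt, ht, hxa, -⟩ := hT x hx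
      exact ⟨hxa, fun t' ht' => H.disjoint t t' x ht ht' ▸ hMt⟩
    · obtain ⟨t, hMt, ht, hxa, -⟩ := hB x hx
      exact ⟨hxa, fun t' ht' => H.disjoint t t' x ht ht' ▸ hMt⟩
  have hpos : ∀ r x, x ∈ corners (L r) (U r) →
      r = if d < x 1 then 1 else if x 1 ≤ c then 2 else 0 := by
    intro r x hx
    fin_cases r
    · rw [Fin.mk_zero, hmem0] at hx
      rw [if_neg hx.2.2.not_gt, if_neg hx.2.1.not_ge]; rfl
    · obtain ⟨t, -, -, -, hxd⟩ := hT x hx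
      rw [if_pos hxd]; rfl
    · obtain ⟨t, -, -, -, hxc⟩ := hB x hx
      rw [if_neg (hxc.trans hcd.le).not_gt, if_pos hxc]; rfl
  have hne : ∀ k ∈ s, k ≠ j := fun k hk e => hjs (e ▸ hk)
  -- Cutting a home piece does not cut its `Z k`: both have the same extent along axis `1`, so if `Z
  -- k` passed the sweep line it would meet `Z j`, at the point `p` below.
  have hhome : ∀ k ∈ s, M (h k) → (Z k).upper 0 ≤ a := by
    rintro k hk ⟨x, hx, hxa, hxc, hxd⟩
    have hx' := mem_corners.1 hx
    rw [H.home_lower_one k hk, H.home_upper_one k hk] at hx'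
    by_contra! hlt
    set p : Plane := ![min ((Z k).upper 0) ((Z j).upper 0), x 1]
    refine (hdis k j (hne k hk)).notMem_of_mem_left (a := p) ?_ ?_
    · rw [coe_rectangle, mem_corners]
      exact ⟨⟨lt_min ((Z k).lower_lt_upper 0) ((hj k hk).trans_lt hab), min_le_left _ _⟩, hx'.2⟩
    · rw [coe_rectangle, mem_corners]
      exact ⟨⟨lt_min hlt hab, min_le_right _ _⟩, hxc, hxd⟩
  refine ⟨Sum.elim l L, Sum.elim u₁ U, fun k => if k = j then Sum.inr 0 else Sum.inl (h k), ?_⟩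
  constructor
  · intro k hk k' hk' e
    simp only [Finset.coe_insert, Set.mem_insert_iff, Finset.mem_coe] at hk hk'
    by_cases h1 : k = j <;> by_cases h2 : k' = j <;> simp only [h1, h2, if_true, if_false] at e ⊢
    · simp at e
    · simp at e
    · exact H.injOn (hk.resolve_left h1) (hk'.resolve_left h2) (Sum.inl_injective e)
  · rintro (t | r) x hx
    · exact H.subset t ((hmem t x).1 hx).1
    · simp only [Sum.elim_inr] at hx
      fin_cases r
      · rw [Fin.mk_zero, hmem0] at hx
        rw [coe_rectangle, mem_corners]
        exact ⟨⟨by linarith, hx.1.2⟩, by linarith, by linarith⟩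
      · obtain ⟨t, -, ht, -⟩ := hT x hx
        exact H.subset t ht
      · obtain ⟨t, -, ht, -⟩ := hB x hx
        exact H.subset t ht
  · rintro (t | r) (t' | r') x hx hx' <;> simp only [Sum.elim_inr, Sum.elim_inl] at hx hx'
    · rw [H.disjoint t t' x ((hmem _ _).1 hx).1 ((hmem _ _).1 hx').1]
    · have h1 := (hmem _ _).1 hx
      have h2 := hnew r' x hx'
      exact ((h1.2 (h2.2 t h1.1)).not_gt h2.1).elim
    · have h1 := (hmem _ _).1 hx'
      have h2 := hnew r x hx
      exact ((h1.2 (h2.2 t' h1.1)).not_gt h2.1).elim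
    · rw [hpos r x hx, hpos r' x hx']
  · intro x hx
    obtain ⟨t, ht⟩ := H.cover x hx
    by_cases h1 : M t ∧ a < x 0
    · obtain ⟨hMt, hxa⟩ := h1
      by_cases h2 : d < x 1
      · exact ⟨Sum.inr 1, hT' t hMt x ht hxa h2⟩
      · by_cases h3 : x 1 ≤ c
        · exact ⟨Sum.inr 2, hB' t hMt x ht hxa h3⟩
        · refine ⟨Sum.inr 0, (hmem0 x).2 ⟨⟨hxa, (hx 0).2⟩, not_le.1 h3, not_lt.1 h2⟩⟩
    · exact ⟨Sum.inl t, (hmem t x).2 ⟨ht, fun hMt => not_lt.1 fun hxa => h1 ⟨hMt, hxa⟩⟩⟩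
  · rintro (t | r)
    · simp only [Sum.elim_inl]
      by_cases h1 : M t
      · refine Or.inr ⟨j, Finset.mem_insert_self j s, ?_⟩
        simp only [hu₁, h1, if_true, Matrix.cons_val_zero]
        exact min_le_right _ _
      · simp only [hu₁, h1, if_false]
        exact (H.ends t).imp_right fun ⟨k, hk, hle⟩ => ⟨k, Finset.mem_insert_of_mem hk, hle⟩
    · left
      fin_cases r
      · rfl
      · exact hTu
      · exact hBu
  · intro k hk
    rcases Finset.mem_insert.1 hk with rfl | hk
    · simp [L]
    · simp only [hne k hk, if_false, Sum.elim_inl]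
      exact H.home_lower k hk
  · intro k hk
    rcases Finset.mem_insert.1 hk with rfl | hk
    · simpa [U] using hC.2.1
    · simp only [hne k hk, if_false, Sum.elim_inl]
      by_cases h1 : M (h k)
      · simp only [hu₁, h1, if_true, Matrix.cons_val_zero]
        exact le_min (H.home_upper k hk) (hhome k hk h1)
      · simp only [hu₁, h1, if_false]
        exact H.home_upper k hk
  · intro k hk
    rcases Finset.mem_insert.1 hk with rfl | hk
    · simp [L]
    · simp only [hne k hk, if_false, Sum.elim_inl]
      exact H.home_lower_one k hk
  · intro k hk
    rcases Finset.mem_insert.1 hk with rfl | hk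
    · simp [U, d]
    · simp only [hne k hk, if_false, Sum.elim_inl]
      by_cases h1 : M (h k)
      · simp only [hu₁, h1, if_true, Matrix.cons_val_one]
        exact H.home_upper_one k hk
      · simp only [hu₁, h1, if_false]
        exact H.home_upper_one k hk

lemma exists_isSweep [DecidableEq κ] (hsub : ∀ j, (Z j : Set Plane) ⊆ C)
    (hdis : ∀ i j, i ≠ j → Disjoint (Z i : Set Plane) (Z j : Set Plane)) (s : Finset κ) :
    ∃ (ι : Type) (_ : Fintype ι) (l u : ι → Plane) (h : κ → ι),
      Fintype.card ι ≤ 3 * s.card + 1 ∧ IsSweep C Z s l u h := by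
  induction s using Finset.induction_on_max_value (fun j => (Z j).lower 0) with
  | empty =>
    refine ⟨Unit, inferInstance, fun _ => C.lower, fun _ => C.upper, fun _ => (), by simp, ?_⟩
    constructor <;> simp [coe_rectangle, corners, BoxIntegral.Box.mem_def]
  | insert j s hjs hj ih =>
    obtain ⟨ι, hι, l, u, h, hcard, H⟩ := ih
    obtain ⟨l', u', h', H'⟩ := H.insert hsub hdis hjs hj
    refine ⟨ι ⊕ Fin 3, inferInstance, l', u', h', ?_, H'⟩
    rw [Finset.card_insert_of_notMem hjs, Fintype.card_sum, Fintype.card_fin]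
    omega

/-- Disjoint rectangles `Z j` extend to a partition of the cake into a few rectangles. -/
lemma exists_partition [Fintype κ] (hsub : ∀ j, (Z j : Set Plane) ⊆ C)
    (hdis : ∀ i j, i ≠ j → Disjoint (Z i : Set Plane) (Z j : Set Plane)) :
    ∃ (ι : Type) (_ : Fintype ι) (P : ι → Rectangle) (h : κ → ι),
      Fintype.card ι ≤ 3 * Fintype.card κ + 1 ∧ Function.Injective h ∧
      (∀ t, (P t : Set Plane) ⊆ C) ∧
      (Pairwise fun t t' => Disjoint (P t : Set Plane) (P t' : Set Plane)) ∧
      (∀ x ∈ C, ∃ t, x ∈ P t) ∧ ∀ j, (Z j : Set Plane) ⊆ P (h j) := by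
  classical
  obtain ⟨ι, hι, l, u, h, hcard, H⟩ := exists_isSweep hsub hdis Finset.univ
  have hZ : ∀ j, (Z j : Set Plane) ⊆ corners (l (h j)) (u (h j)) := by
    intro j x hx
    rw [coe_rectangle, mem_corners] at hx
    have h1 := H.home_lower j (Finset.mem_univ j)
    have h2 := H.home_upper j (Finset.mem_univ j)
    rw [mem_corners, H.home_lower_one j (Finset.mem_univ j), H.home_upper_one j (Finset.mem_univ j)]
    exact ⟨⟨by linarith, by linarith⟩, hx.2⟩
  have hlt : ∀ {t x}, x ∈ corners (l t) (u t) → ∀ d, l t d < u t d :=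
    fun hx d => (hx d).1.trans_le (hx d).2
  -- Empty pieces of the sweep are discarded, as a `Rectangle` has positive width and height.
  refine ⟨{t // ∀ d, l t d < u t d}, inferInstance, fun t => ⟨l t, u t, t.2⟩,
    fun j => ⟨h j, hlt (hZ j (Z j).upper_mem)⟩, ?_, ?_, ?_, ?_, ?_, ?_⟩
  · exact (Fintype.card_subtype_le _).trans hcard
  · intro j j' e
    exact H.injOn (by simp) (by simp) (Subtype.ext_iff.1 e)
  · intro t
    rw [coe_rectangle]
    exact H.subset t
  · intro t t' htt'
    rw [Set.disjoint_left]
    intro x hx hx'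
    rw [coe_rectangle] at hx hx'
    exact htt' (Subtype.ext (H.disjoint t t' x hx hx'))
  · intro x hx
    obtain ⟨t, ht⟩ := H.cover x hx
    exact ⟨⟨t, hlt ht⟩, ht⟩
  · intro j
    rw [coe_rectangle (BoxIntegral.Box.mk _ _ _)]
    exact hZ j

end Partition
/-! ### Values of rectangles -/

section Value

variable {C : Rectangle} {v : Plane → ℝ}

lemma value_nonneg (hv : IsValueDensity C v) {A : Set Plane} (hA : A ⊆ C)
    (hm : MeasurableSet A) : 0 ≤ value v A :=
  setIntegral_nonneg hm fun x hx => hv.nonneg x (hA hx)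

lemma value_mono (hv : IsValueDensity C v) {A B : Set Plane} (hAB : A ⊆ B) (hB : B ⊆ C)
    (hm : MeasurableSet B) : value v A ≤ value v B := by
  refine setIntegral_mono_set (hv.integrableOn.mono_set hB) ?_ hAB.eventuallyLE
  exact (ae_restrict_iff' hm).2 (Filter.Eventually.of_forall fun x hx => hv.nonneg x (hB hx))

lemma measurableSet_lowerPart (R : Rectangle) (d : Fin 2) (t : ℝ) :
    MeasurableSet (lowerPart R d t) :=
  R.measurableSet_coe.inter (measurableSet_le (measurable_pi_apply d) measurable_const)

lemma value_eq_sum {ι : Type} [Fintype ι] (hv : IsValueDensity C v) (P : ι → Rectangle)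
    (hsub : ∀ t, (P t : Set Plane) ⊆ C)
    (hdis : Pairwise fun t t' => Disjoint (P t : Set Plane) (P t' : Set Plane))
    (hcov : ∀ x ∈ C, ∃ t, x ∈ P t) : value v C = ∑ t, value v (P t) := by
  have hU : (C : Set Plane) = ⋃ t, (P t : Set Plane) := by
    ext x
    simp only [Set.mem_iUnion]
    exact ⟨fun hx => hcov x hx, fun ⟨t, ht⟩ => hsub t ht⟩
  unfold value
  rw [hU, integral_iUnion_fintype (fun t => (P t).measurableSet_coe) hdis
    fun t => hv.integrableOn.mono_set (hsub t)]

end Value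

/-! ### Composing protocols -/

section Solvable

variable {n : ℕ} {α β : Type} {C : Rectangle}

/-- Some protocol achieves the postcondition `Post` with at most `q` queries for all agents whose
value-densities satisfy the precondition `Pre`. -/
def Solvable (C : Rectangle) (Pre : (Fin n → Plane → ℝ) → Prop)
    (Post : (Fin n → Plane → ℝ) → β → Prop) (q : ℕ) : Prop :=
  ∃ P : Protocol n β, ∀ v, (∀ i, IsValueDensity C (v i)) → Pre v → P.Achieves C v (Post v) q

/-- Run a protocol and continue with a protocol that depends on its output. -/
def Protocol.bind : Protocol n α → (α → Protocol n β) → Protocol n β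
  | .done a, f => f a
  | .eval i R next, f => .eval i R fun r => (next r).bind f
  | .mark i R d a next, f => .mark i R d a fun r => (next r).bind f

lemma Protocol.Achieves.mono {v : Fin n → Plane → ℝ} {Good Good' : β → Prop}
    (hG : ∀ b, Good b → Good' b) {P : Protocol n β} :
    ∀ {q q' : ℕ}, q ≤ q' → P.Achieves C v Good q → P.Achieves C v Good' q' := by
  induction P with
  | done b => intro q q' _ h; simp only [Protocol.Achieves] at h ⊢; exact hG b h
  | eval i R next ih =>
    intro q q' hq h
    cases q with
    | zero => simp [Protocol.Achieves] at h
    | succ q =>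
      obtain ⟨q', rfl⟩ : ∃ p, q' = p + 1 := ⟨q' - 1, by omega⟩
      simp only [Protocol.Achieves] at h ⊢
      exact ⟨h.1, ih _ (by omega) h.2⟩
  | mark i R d a next ih =>
    intro q q' hq h
    cases q with
    | zero => simp [Protocol.Achieves] at h
    | succ q =>
      obtain ⟨q', rfl⟩ : ∃ p, q' = p + 1 := ⟨q' - 1, by omega⟩
      simp only [Protocol.Achieves] at h ⊢
      exact ⟨h.1, h.2.1, h.2.2.1, fun t ht hta => ih _ (by omega) (h.2.2.2 t ht hta)⟩

lemma Protocol.Achieves.bind {v : Fin n → Plane → ℝ} {Good : β → Prop} {P : Protocol n α}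
    {f : α → Protocol n β} {p : ℕ} : ∀ {q : ℕ},
    P.Achieves C v (fun a => (f a).Achieves C v Good p) q →
      (P.bind f).Achieves C v Good (q + p) := by
  induction P with
  | done a =>
    intro q h
    simp only [Protocol.Achieves] at h
    exact h.mono (fun _ => id) (by omega)
  | eval i R next ih =>
    intro q h
    cases q with
    | zero => simp [Protocol.Achieves] at h
    | succ q =>
      rw [Nat.add_right_comm]
      simp only [Protocol.Achieves, Protocol.bind] at h ⊢
      exact ⟨h.1, ih _ h.2⟩
  | mark i R d a next ih =>
    intro q h
    cases q with
    | zero => simp [Protocol.Achieves] at h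
    | succ q =>
      rw [Nat.add_right_comm]
      simp only [Protocol.Achieves, Protocol.bind] at h ⊢
      exact ⟨h.1, h.2.1, h.2.2.1, fun t ht hta => ih _ (h.2.2.2 t ht hta)⟩

variable {Pre : (Fin n → Plane → ℝ) → Prop}

lemma Solvable.pure {Post : (Fin n → Plane → ℝ) → β → Prop} (b : β)
    (h : ∀ v, (∀ i, IsValueDensity C (v i)) → Pre v → Post v b) (q : ℕ) :
    Solvable C Pre Post q :=
  ⟨.done b, fun v hv hp => by simpa only [Protocol.Achieves] using h v hv hp⟩

/-- The continuation is chosen for each output separately; about the densities it may use only `Pre`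
and what the output certifies. -/
lemma Solvable.bind {Mid : (Fin n → Plane → ℝ) → α → Prop}
    {Post : (Fin n → Plane → ℝ) → β → Prop} {p q : ℕ} (h : Solvable C Pre Mid q)
    (h' : ∀ a, Solvable C (fun v => Pre v ∧ Mid v a) Post p) :
    Solvable C Pre Post (q + p) := by
  obtain ⟨P, hP⟩ := h
  choose f hf using h'
  refine ⟨P.bind f, fun v hv hp => Protocol.Achieves.bind ?_⟩
  exact (hP v hv hp).mono (fun a ha => hf a v hv ⟨hp, ha⟩) le_rfl

lemma Solvable.mono {Pre' : (Fin n → Plane → ℝ) → Prop}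
    {Post Post' : (Fin n → Plane → ℝ) → β → Prop} {q q' : ℕ}
    (h : Solvable C Pre Post q) (hPre : ∀ v, Pre' v → Pre v)
    (hPost : ∀ v, (∀ i, IsValueDensity C (v i)) → Pre' v → ∀ b, Post v b → Post' v b)
    (hq : q ≤ q') : Solvable C Pre' Post' q' := by
  obtain ⟨P, hP⟩ := h
  exact ⟨P, fun v hv hp => (hP v hv (hPre v hp)).mono (hPost v hv hp) hq⟩

/-- A property of the known data may be assumed if the precondition implies it. -/
lemma Solvable.of_imp [Inhabited β] {Post : (Fin n → Plane → ℝ) → β → Prop} {q : ℕ} (p : Prop)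
    (hp : ∀ v, (∀ i, IsValueDensity C (v i)) → Pre v → p) (h : p → Solvable C Pre Post q) :
    Solvable C Pre Post q := by
  by_cases hp' : p
  · exact h hp'
  -- No densities satisfy `Pre` here, so any output will do.
  · exact ⟨.done default, fun v hv hv' => (hp' (hp v hv hv')).elim⟩

lemma Solvable.forall_mem {κ : Type} [DecidableEq κ] [Inhabited β] (s : Finset κ)
    {Post : κ → (Fin n → Plane → ℝ) → β → Prop} {q : κ → ℕ}
    (h : ∀ k ∈ s, Solvable C Pre (Post k) (q k)) :
    Solvable C Pre (fun v (f : κ → β) => ∀ k ∈ s, Post k v (f k)) (∑ k ∈ s, q k) := by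
  induction s using Finset.induction_on with
  | empty => exact Solvable.pure (fun _ => default) (by simp) _
  | insert a s ha ih =>
    rw [Finset.sum_insert ha]
    refine (h a (Finset.mem_insert_self a s)).bind fun b => ?_
    rw [← Nat.add_zero (∑ k ∈ s, q k)]
    refine Solvable.bind ((ih fun k hk => h k (Finset.mem_insert_of_mem hk)).mono
      (fun v hv => hv.1) (fun _ _ _ _ hf => hf) le_rfl) fun f => ?_
    refine Solvable.pure (Function.update f a b) (fun v _ hv k hk => ?_) 0
    by_cases hka : k = a
    · subst hka
      rw [Function.update_self]
      exact hv.1.2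
    · rw [Function.update_of_ne hka]
      exact hv.2 k (Finset.mem_of_mem_insert_of_ne hk hka)

lemma Solvable.eval (i : Fin n) {R : Rectangle} (hR : (R : Set Plane) ⊆ C) :
    Solvable C Pre (fun v r => r = value (v i) R) 1 :=
  ⟨.eval i R .done, fun v _ _ => by simp only [Protocol.Achieves]; exact ⟨hR, trivial⟩⟩

/-- Two queries suffice to cut, properly, a given fraction of a rectangle. -/
lemma Solvable.cut (i : Fin n) {R : Rectangle} (hR : (R : Set Plane) ⊆ C) {c : ℝ} (hc0 : 0 < c)
    (hc1 : c < 1) :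
    Solvable C Pre (fun v t => R.lower 0 < t ∧ t < R.upper 0 ∧
      value (v i) (lowerPart R 0 t) = c * value (v i) R) 2 := by
  refine Solvable.bind (Solvable.eval i hR) (p := 1) fun r => ?_
  have hlt := R.lower_lt_upper 0
  -- With positive value, every truthful mark is interior because `0 < c < 1`. With value zero, a
  -- mark might fall on an edge, so the midpoint is taken without a query.
  by_cases hr : 0 < r
  · refine ⟨.mark i R 0 (c * r) .done, fun v hv hp => ?_⟩
    obtain ⟨-, rfl⟩ := hp
    simp only [Protocol.Achieves]
    refine ⟨hR, by positivity, by nlinarith, fun t ht hta => ⟨?_, ?_, hta⟩⟩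
    · refine lt_of_le_of_ne ht.1 fun h => ?_
      have : lowerPart R 0 t = ∅ := by
        ext x
        simp only [lowerPart, Set.mem_ofPred_eq, Set.mem_empty_iff_false, iff_false, not_and,
          not_le, ← h]
        exact fun hx => (hx 0).1
      rw [this] at hta
      simp only [value, setIntegral_empty] at hta hr
      have := mul_pos hc0 hr
      linarith
    · refine lt_of_le_of_ne ht.2 fun h => ?_
      have : lowerPart R 0 t = R := by
        ext x
        simp only [lowerPart, Set.mem_ofPred_eq, h]
        exact ⟨fun hx => hx.1, fun hx => ⟨hx, (hx 0).2⟩⟩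
      rw [this] at hta
      nlinarith
  · refine Solvable.pure ((R.lower 0 + R.upper 0) / 2) (fun v hv hp => ?_) 1
    refine ⟨by linarith, by linarith, ?_⟩
    have h0 : value (v i) R = 0 :=
      le_antisymm (hp.2 ▸ not_lt.1 hr) (value_nonneg (hv i) hR R.measurableSet_coe)
    have hsub : lowerPart R 0 ((R.lower 0 + R.upper 0) / 2) ⊆ (R : Set Plane) := fun x hx => hx.1
    rw [h0, mul_zero]
    refine le_antisymm (h0 ▸ value_mono (hv i) hsub hR R.measurableSet_coe) ?_
    exact value_nonneg (hv i) (hsub.trans hR) (measurableSet_lowerPart _ _ _)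

end Solvable

/-! ### Proportional division of a rectangle -/

section Divide

variable {n : ℕ} {C : Rectangle}

/-- Applied to marks, this selects the agents with the `k` lowest ones. -/
lemma exists_subset_card_le {κ α : Type*} [DecidableEq κ] [LinearOrder α] (f : κ → α)
    (G : Finset κ) (k : ℕ) (hk : k ≤ G.card) :
    ∃ G' ⊆ G, G'.card = k ∧ ∀ i ∈ G', ∀ j ∈ G \ G', f i ≤ f j := by
  induction k with
  | zero => exact ⟨∅, by simp⟩
  | succ k ih =>
    obtain ⟨G', hsub, hcard, hle⟩ := ih (by omega)
    have hne : (G \ G').Nonempty := by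
      rw [← Finset.card_pos, Finset.card_sdiff_of_subset hsub]
      omega
    obtain ⟨x, hx, hmin⟩ := Finset.exists_min_image _ f hne
    have hx' := Finset.mem_sdiff.1 hx
    refine ⟨insert x G', Finset.insert_subset hx'.1 hsub, ?_, fun i hi j hj => ?_⟩
    · rw [Finset.card_insert_of_notMem hx'.2, hcard]
    · have hj' : j ∈ G \ G' := by
        simp only [Finset.mem_sdiff, Finset.mem_insert, not_or] at hj ⊢
        exact ⟨hj.1, hj.2.2⟩
      rcases Finset.mem_insert.1 hi with rfl | hi
      · exact hmin j hj'
      · exact hle i hi j hj'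

lemma exists_split (R : Rectangle) {t : ℝ} (h1 : R.lower 0 < t) (h2 : t < R.upper 0) :
    ∃ A B : Rectangle, (A : Set Plane) = lowerPart R 0 t ∧
      (B : Set Plane) = {x | x ∈ R ∧ t < x 0} := by
  refine ⟨⟨R.lower, Function.update R.upper 0 t, ?_⟩, ⟨Function.update R.lower 0 t, R.upper, ?_⟩,
    ?_, ?_⟩
  · intro d
    fin_cases d
    · simpa using h1
    · simp
  · intro d
    fin_cases d
    · simpa using h2
    · simp
  · ext x
    simp only [BoxIntegral.Box.mem_coe, BoxIntegral.Box.mem_def, lowerPart, Set.mem_ofPred_eq,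
      Fin.forall_fin_two, Set.mem_Ioc, Function.update_self, ne_eq, one_ne_zero,
      not_false_eq_true, Function.update_of_ne]
    constructor
    · rintro ⟨⟨a, b⟩, c, d⟩
      exact ⟨⟨⟨a, by linarith⟩, c, d⟩, b⟩
    · rintro ⟨⟨⟨a, _⟩, c, d⟩, b⟩
      exact ⟨⟨a, b⟩, c, d⟩
  · ext x
    simp only [BoxIntegral.Box.mem_coe, BoxIntegral.Box.mem_def, Set.mem_ofPred_eq,
      Fin.forall_fin_two, Set.mem_Ioc, Function.update_self, ne_eq, one_ne_zero,
      not_false_eq_true, Function.update_of_ne]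
    constructor
    · rintro ⟨⟨a, b⟩, c, d⟩
      exact ⟨⟨⟨by linarith, b⟩, c, d⟩, a⟩
    · rintro ⟨⟨⟨_, b⟩, c, d⟩, a⟩
      exact ⟨⟨a, b⟩, c, d⟩

/-- The rectangles `X i` with `i ∈ G` are a proportional division of `R`. -/
structure IsDivision (R : Rectangle) (G : Finset (Fin n)) (v : Fin n → Plane → ℝ)
    (X : Fin n → Rectangle) : Prop where
  subset : ∀ i ∈ G, (X i : Set Plane) ⊆ R
  disjoint : ∀ i ∈ G, ∀ j ∈ G, i ≠ j → Disjoint (X i : Set Plane) (X j : Set Plane)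
  proportional : ∀ i ∈ G, value (v i) R ≤ G.card * value (v i) (X i)

instance : Inhabited Rectangle := ⟨⟨0, 1, fun _ => zero_lt_one⟩⟩

lemma IsDivision.of_card_le_one (R : Rectangle) {G : Finset (Fin n)} (hG : G.card ≤ 1)
    (v : Fin n → Plane → ℝ) : IsDivision R G v fun _ => R where
  subset _ _ := subset_rfl
  disjoint i hi j hj hij := (hij (Finset.card_le_one.1 hG i hi j hj)).elim
  proportional i hi := by
    have : G.card = 1 := le_antisymm hG (Finset.card_pos.2 ⟨i, hi⟩)
    simp [this]

/-- Agents whose mark is at most `t` value `A` at no less than the fraction `G'.card / G.card` of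
`R`; for those whose mark is at least `t`, `A` is worth at most this fraction, which leaves enough
in `B`. Proportionality in the parts thus multiplies to proportionality in `R`. -/
lemma IsDivision.union {R A B : Rectangle} {t : ℝ} (hA : (A : Set Plane) = lowerPart R 0 t)
    (hB : (B : Set Plane) = {x | x ∈ R ∧ t < x 0}) (hR : (R : Set Plane) ⊆ C)
    {G G' : Finset (Fin n)} (hG' : G' ⊆ G) (hpos : 0 < G'.card) (hlt : G'.card < G.card)
    {v : Fin n → Plane → ℝ} (hv : ∀ i, IsValueDensity C (v i)) {f : Fin n → ℝ}
    (hf : ∀ i ∈ G, value (v i) (lowerPart R 0 (f i)) = G'.card / G.card * value (v i) R)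
    (hle : ∀ i ∈ G', f i ≤ t) (hge : ∀ i ∈ G \ G', t ≤ f i) {X Y : Fin n → Rectangle}
    (hX : IsDivision A G' v X) (hY : IsDivision B (G \ G') v Y) :
    IsDivision R G v fun i => if i ∈ G' then X i else Y i := by
  have hAR : (A : Set Plane) ⊆ R := by rw [hA]; exact fun x hx => hx.1
  have hBR : (B : Set Plane) ⊆ R := by rw [hB]; exact fun x hx => hx.1
  have hAB : Disjoint (A : Set Plane) (B : Set Plane) := by
    rw [hA, hB, Set.disjoint_left]
    exact fun x hx hx' => hx.2.not_gt hx'.2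
  have hgpos : (0 : ℝ) < G.card := by exact_mod_cast hpos.trans hlt
  refine ⟨fun i hi => ?_, fun i hi j hj hij => ?_, fun i hi => ?_⟩
  · by_cases h : i ∈ G'
    · simpa only [h, if_true] using (hX.subset i h).trans hAR
    · simpa only [h, if_false] using (hY.subset i (Finset.mem_sdiff.2 ⟨hi, h⟩)).trans hBR
  · by_cases h : i ∈ G' <;> by_cases h' : j ∈ G' <;> simp only [h, h', if_true, if_false]
    · exact hX.disjoint i h j h' hij
    · exact hAB.mono (hX.subset i h) (hY.subset j (Finset.mem_sdiff.2 ⟨hj, h'⟩))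
    · exact (hAB.mono (hX.subset j h') (hY.subset i (Finset.mem_sdiff.2 ⟨hi, h⟩))).symm
    · exact hY.disjoint i (Finset.mem_sdiff.2 ⟨hi, h⟩) j (Finset.mem_sdiff.2 ⟨hj, h'⟩) hij
  · by_cases h : i ∈ G'
    · simp only [h, if_true]
      have h1 := hX.proportional i h
      have h2 : value (v i) (lowerPart R 0 (f i)) ≤ value (v i) A :=
        value_mono (hv i) (hA ▸ fun x hx => ⟨hx.1, hx.2.trans (hle i h)⟩) (hAR.trans hR)
          A.measurableSet_coe
      rw [hf i hi, div_mul_eq_mul_div, div_le_iff₀ hgpos] at h2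
      have hg' : (0 : ℝ) < G'.card := by exact_mod_cast hpos
      nlinarith
    · simp only [h, if_false]
      have hi' := Finset.mem_sdiff.2 ⟨hi, h⟩
      have h1 := hY.proportional i hi'
      have h2 : value (v i) A ≤ value (v i) (lowerPart R 0 (f i)) :=
        value_mono (hv i) (hA ▸ fun x hx => ⟨hx.1, hx.2.trans (hge i hi')⟩)
          (fun x hx => hR hx.1) (measurableSet_lowerPart _ _ _)
      have h3 : value (v i) R = value (v i) A + value (v i) B := by
        have hU : (R : Set Plane) = (A : Set Plane) ∪ (B : Set Plane) := by
          rw [hA, hB]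
          ext x
          simp only [lowerPart, Set.mem_union, Set.mem_ofPred_eq, ← and_or_left]
          exact ⟨fun hx => ⟨hx, le_or_gt _ _⟩, fun hx => hx.1⟩
        unfold value
        rw [hU, setIntegral_union hAB B.measurableSet_coe
          ((hv i).integrableOn.mono_set (hAR.trans hR))
          ((hv i).integrableOn.mono_set (hBR.trans hR))]
      rw [hf i hi, div_mul_eq_mul_div, le_div_iff₀ hgpos] at h2
      rw [Finset.card_sdiff_of_subset hG', Nat.cast_sub hlt.le] at h1
      have hg' : (0 : ℝ) < G.card - G'.card := by
        rw [sub_pos]; exact_mod_cast hlt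
      nlinarith

/-- Proportional division by halving. -/
lemma solvable_isDivision (h : ℕ) : ∀ (G : Finset (Fin n)) (R : Rectangle),
    G.card ≤ 2 ^ h → (R : Set Plane) ⊆ C →
      Solvable C (fun _ => True) (fun v X => IsDivision R G v X) (2 * G.card * h) := by
  induction h with
  | zero =>
    intro G R hG _
    exact Solvable.pure (fun _ => R) (fun v _ _ => IsDivision.of_card_le_one R (by simpa using hG) v)
      _
  | succ h ih =>
    intro G R hG hR
    rcases Nat.lt_or_ge 1 G.card with hone | hone
    swap
    · exact Solvable.pure (fun _ => R) (fun v _ _ => IsDivision.of_card_le_one R hone v) _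
    set g := G.card / 2 with hg
    have hgpos : 0 < g := by omega
    have hglt : g < G.card := by omega
    have hc0 : (0 : ℝ) < g / G.card := by positivity
    have hc1 : (g : ℝ) / G.card < 1 := by
      rw [div_lt_one (by positivity)]; exact_mod_cast hglt
    have hcut := Solvable.forall_mem (Pre := fun _ => True) G
      fun i _ => Solvable.cut i hR hc0 hc1 (Pre := fun _ => True)
    rw [Finset.sum_const, smul_eq_mul] at hcut
    have hcost : 2 * G.card * (h + 1) = G.card * 2 + 2 * G.card * h := by ring
    rw [hcost]
    refine hcut.bind fun f => ?_
    -- Interior marks ensure that both parts of the cut are genuine rectangles.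
    refine Solvable.of_imp (∀ i ∈ G, R.lower 0 < f i ∧ f i < R.upper 0)
      (fun v _ hv i hi => ⟨(hv.2 i hi).1, (hv.2 i hi).2.1⟩) fun hf => ?_
    obtain ⟨G', hG', hcard, hle⟩ := exists_subset_card_le f G g hglt.le
    -- The cut is at the highest mark of `G'`, which separates the marks of `G'` from the others.
    obtain ⟨x, hx, hmax⟩ := Finset.exists_max_image G' f (Finset.card_pos.1 (by omega))
    obtain ⟨A, B, hA, hB⟩ := exists_split R (hf x (hG' hx)).1 (hf x (hG' hx)).2
    have hcard' : (G \ G').card = G.card - g := by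
      rw [Finset.card_sdiff_of_subset hG', hcard]
    have hAR : (A : Set Plane) ⊆ R := by rw [hA]; exact fun x hx => hx.1
    have hBR : (B : Set Plane) ⊆ R := by rw [hB]; exact fun x hx => hx.1
    rw [pow_succ] at hG
    -- The cost is linear in the number of agents, so the two halves together cost as much as one
    -- level for all.
    have hsum : 2 * G.card * h = 2 * G'.card * h + (2 * (G \ G').card * h + 0) := by
      rw [hcard, hcard', add_zero, ← add_mul, ← mul_add]
      congr 2
      omega
    rw [hsum]
    refine ((ih G' A (by omega) (hAR.trans hR)).mono (fun _ _ => trivial)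
      (fun _ _ _ _ h => h) le_rfl).bind fun X => ?_
    refine ((ih (G \ G') B (by omega) (hBR.trans hR)).mono (fun _ _ => trivial)
      (fun _ _ _ _ h => h) le_rfl).bind fun Y => ?_
    refine Solvable.pure (fun i => if i ∈ G' then X i else Y i) (fun v hv hp => ?_) 0
    refine IsDivision.union hA hB hR hG' (by omega) (by omega) hv (f := f) (fun i hi => ?_) hmax
      (hle x hx) hp.1.2 hp.2
    rw [hcard]
    exact (hp.1.1.2 i hi).2.2

end Divide
/-! ### The redivision protocol -/

section Redivision

variable {m n : ℕ} {C : Rectangle}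

/-- Gradual retention holds if the owner of the old piece `j` keeps at least the part
`1 / (N j + 1)` of its value, where the `N j` sum to at most `n`. -/
lemma gradualRetention_of_load (hmn : m ≤ n) (hn : 0 < n) {v : Fin n → Plane → ℝ}
    (hv : ∀ i, IsValueDensity C (v i)) {Z : Fin m → Rectangle} {X : Fin n → Rectangle}
    (hX : ∀ i, (X i : Set Plane) ⊆ C) (N : Fin m → ℕ) (hN : ∀ s : Finset (Fin m), ∑ j ∈ s, N j ≤ n)
    (h : ∀ j, value (v (Fin.castLE hmn j)) (Z j) ≤
      (N j + 1) * value (v (Fin.castLE hmn j)) (X (Fin.castLE hmn j))) :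
    GradualRetention hmn v Z X := by
  intro k hk1 _
  have hkpos : (0 : ℝ) < k := by exact_mod_cast hk1
  set c := ⌈(n : ℝ) / k⌉₊ with hc
  have hcpos : 0 < c := Nat.ceil_pos.2 (div_pos (by exact_mod_cast hn) hkpos)
  have hnk : n ≤ c * k := by
    have := Nat.le_ceil ((n : ℝ) / k)
    rw [div_le_iff₀ hkpos] at this
    exact_mod_cast this
  refine ⟨Finset.univ.filter fun j => N j + 1 ≤ c, ?_, fun j hj => ?_⟩
  · have h1 := Finset.card_filter_add_card_filter_not (s := (Finset.univ : Finset (Fin m)))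
      (fun j => N j + 1 ≤ c)
    rw [Finset.card_univ, Fintype.card_fin] at h1
    -- Each exceptional `j` has `N j ≥ c`; as the `N j` sum to at most `n ≤ c * k`, there are at
    -- most `k` of them.
    have h2 : (Finset.univ.filter fun j => ¬ N j + 1 ≤ c).card * c ≤
        ∑ j ∈ Finset.univ.filter fun j => ¬ N j + 1 ≤ c, N j := by
      rw [← smul_eq_mul]
      refine Finset.card_nsmul_le_sum _ _ _ fun j hj => ?_
      have := (Finset.mem_filter.1 hj).2
      omega
    have h3 := (h2.trans (hN _)).trans hnk
    rw [mul_comm c] at h3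
    have h4 := Nat.le_of_mul_le_mul_right h3 hcpos
    omega
  · have hj' : ((N j : ℝ) + 1) ≤ c := by exact_mod_cast (Finset.mem_filter.1 hj).2
    rw [one_div, inv_mul_le_iff₀ (by exact_mod_cast hcpos)]
    exact (h j).trans (mul_le_mul_of_nonneg_right hj'
      (value_nonneg (hv _) (hX _) (X _).measurableSet_coe))

lemma solvable_redivision (hmn : m ≤ n) (hn : 0 < n) (Z : Fin m → Rectangle)
    (hZ : IsAllocation C Z) :
    Solvable C (fun _ => True) (fun v X => IsAllocation C X ∧ IsProportional (1 / 4) C v X ∧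
      GradualRetention hmn v Z X) (n * (3 * m + 1) + 2 * n * Nat.clog 2 n) := by
  classical
  obtain ⟨ι, _, P, h, hcard, hinj, hsub, hdis, hcov, hZP⟩ := exists_partition hZ.subset hZ.disjoint
  rw [Fintype.card_fin] at hcard
  have hne : Nonempty ι := ⟨(hcov _ C.upper_mem).choose⟩
  have heval := Solvable.forall_mem (Pre := fun _ => True) (Finset.univ : Finset (Fin n × ι))
    fun p _ => Solvable.eval p.1 (hsub p.2)
  rw [Finset.sum_const, Finset.card_univ, Fintype.card_prod, Fintype.card_fin, smul_eq_mul,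
    mul_one] at heval
  refine (heval.mono (fun _ h => h) (fun _ _ _ _ h => h) (Nat.mul_le_mul_left n hcard)).bind
    fun w => ?_
  -- The assignment must be computed from the answers `w` alone, so their nonnegativity is first
  -- made a fact about `w`.
  refine Solvable.of_imp (∀ i t, 0 ≤ w (i, t)) (fun v hv hp i t => ?_) fun hw => ?_
  · rw [hp.2 (i, t) (Finset.mem_univ _)]
    exact value_nonneg (hv i) (hsub t) (P t).measurableSet_coe
  -- `4 * n` works because there are at most `3 * m + 1 ≤ 3 * n + 1` pieces and `n` agents; this is
  -- the origin of the factor `1 / 4`.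
  obtain ⟨σ, hσ, hhome⟩ := exists_assignment (fun i t => w (i, t)) hw
    (fun i => if hi : i.val < m then some (h ⟨i, hi⟩) else none) (4 * n)
    (by rw [Fintype.card_fin]; omega)
  have hdiv := Solvable.forall_mem (C := C) (Pre := fun _ => True) (Finset.univ : Finset ι)
    fun t _ => solvable_isDivision (Nat.clog 2 n) (Finset.univ.filter fun i => some (σ i) = some t)
      (P t) (((Finset.card_le_univ _).trans_eq (Fintype.card_fin n)).trans
        (Nat.le_pow_clog one_lt_two n)) (hsub t)
  have hcost : ∑ t, 2 * (Finset.univ.filter fun i => some (σ i) = some t).card * Nat.clog 2 n ≤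
      2 * n * Nat.clog 2 n := by
    rw [← Finset.sum_mul, ← Finset.mul_sum]
    have := sum_load_le (fun i => some (σ i)) Finset.univ
    rw [Fintype.card_fin] at this
    exact Nat.mul_le_mul_right _ (Nat.mul_le_mul_left _ this)
  rw [← Nat.add_zero (2 * n * Nat.clog 2 n)]
  refine (hdiv.mono (fun _ _ => trivial) (fun _ _ _ _ h => h) hcost).bind fun F => ?_
  refine Solvable.pure (fun i => F (σ i) i) (fun v hv hp => ?_) 0
  obtain ⟨⟨-, hwv⟩, hF⟩ := hp
  have hmem : ∀ i, i ∈ Finset.univ.filter fun i' => some (σ i') = some (σ i) := by simp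
  have hXP : ∀ i, (F (σ i) i : Set Plane) ⊆ P (σ i) := fun i =>
    (hF (σ i) (Finset.mem_univ _)).subset i (hmem i)
  have hXC := fun i => (hXP i).trans (hsub (σ i))
  have hsum : ∀ i, ∑ t, w (i, t) = value (v i) C := by
    intro i
    rw [value_eq_sum (hv i) P hsub hdis hcov]
    exact Finset.sum_congr rfl fun t _ => hwv (i, t) (Finset.mem_univ _)
  have hshare : ∀ i, value (v i) (P (σ i)) ≤
      load (fun i => some (σ i)) (σ i) * value (v i) (F (σ i) i) := fun i =>
    (hF (σ i) (Finset.mem_univ _)).proportional i (hmem i)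
  have hnpos : (0 : ℝ) < n := by exact_mod_cast hn
  have hprop : ∀ i, value (v i) C ≤ 4 * n * value (v i) (F (σ i) i) := by
    intro i
    have h1 := hσ i
    rw [hsum, hwv (i, _) (Finset.mem_univ _)] at h1
    push_cast at h1
    have hpos : (0 : ℝ) < load (fun i => some (σ i)) (σ i) := by
      exact_mod_cast Finset.card_pos.2 ⟨i, hmem i⟩
    refine le_of_mul_le_mul_left ?_ hpos
    calc _ ≤ 4 * n * value (v i) (P (σ i)) := h1
      _ ≤ 4 * n * (load (fun i => some (σ i)) (σ i) * value (v i) (F (σ i) i)) := by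
        gcongr
        exact hshare i
      _ = _ := by ring
  refine ⟨⟨hXC, fun i j hij => ?_⟩, fun i => ?_, ?_⟩
  · by_cases hs : σ i = σ j
    · rw [← hs]
      exact (hF (σ i) (Finset.mem_univ _)).disjoint i (hmem i) j (by simp [hs]) hij
    · exact (hdis hs).mono (hXP i) (hXP j)
  · have := hprop i
    rw [div_div, div_mul_eq_mul_div, one_mul, div_le_iff₀ (by positivity)]
    linarith
  · refine gradualRetention_of_load hmn hn hv hXC (fun j => load (fun i => some (σ i)) (h j))
      (fun s => ?_) fun j => ?_
    · have := sum_load_le (fun i => some (σ i)) (s.map ⟨h, hinj⟩)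
      rwa [Finset.sum_map, Fintype.card_fin] at this
    · set i := Fin.castLE hmn j with hi
      refine (value_mono (hv i) (hZP j) (hsub _) (P _).measurableSet_coe).trans ?_
      have hXnonneg := value_nonneg (hv i) (hXC i) (F (σ i) i).measurableSet_coe
      -- An agent at home has the stronger factor `load`; one sent away compares its small home with
      -- its proportional share of the cake.
      rcases hhome i (h j) (by simp [hi]) with he | hle
      · have := hshare i
        rw [he] at this ⊢
        rw [he] at hXnonneg
        linarith
      · rw [hsum, hwv (i, _) (Finset.mem_univ _)] at hle
        push_cast at hle
        refine le_of_mul_le_mul_left ?_ (by positivity : (0 : ℝ) < 4 * n)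
        calc _ ≤ (load (fun i => some (σ i)) (h j) + 1) * value (v i) C := hle
          _ ≤ (load (fun i => some (σ i)) (h j) + 1) * (4 * n * value (v i) (F (σ i) i)) := by
            gcongr
            exact hprop i
          _ = _ := by ring

/-- Each summand is at most `8 * (m * n * log n)`: the first since `3 * m + 1 ≤ 4 * m` and `log n ≥
1 / 2`, the second since `clog 2 n ≤ log 2 n + 1 ≤ 4 * log n`, with the base-two logarithms rounded
to integers. -/
lemma query_bound (hm : 1 ≤ m) (hn : 2 ≤ n) :
    ((n * (3 * m + 1) + 2 * n * Nat.clog 2 n : ℕ) : ℝ) ≤ 16 * (m * n * Real.log n) := by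
  have hlog2 : (1 / 2 : ℝ) < Real.log 2 := by linarith [Real.log_two_gt_d9]
  have hn' : (2 : ℝ) ≤ n := by exact_mod_cast hn
  have hm' : (1 : ℝ) ≤ m := by exact_mod_cast hm
  have hlogn : 1 / 2 ≤ Real.log n := hlog2.le.trans (Real.log_le_log (by norm_num) hn')
  have hlog : (Nat.log 2 n : ℝ) ≤ 2 * Real.log n := by
    have h1 : ((2 : ℝ) ^ Nat.log 2 n) ≤ n := by
      exact_mod_cast Nat.pow_log_le_self 2 (by omega)
    have h2 := Real.log_le_log (by positivity) h1
    rw [Real.log_pow] at h2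
    have : (0 : ℝ) ≤ Nat.log 2 n := Nat.cast_nonneg _
    nlinarith
  have hclog : (Nat.clog 2 n : ℝ) ≤ 4 * Real.log n := by
    have h1 : Nat.clog 2 n ≤ Nat.log 2 n + 1 := by
      refine Nat.clog_le_of_le_pow ?_
      exact (Nat.lt_pow_succ_log_self one_lt_two n).le
    have h2 : (Nat.clog 2 n : ℝ) ≤ Nat.log 2 n + 1 := by exact_mod_cast h1
    linarith
  push_cast
  have h1 : (n : ℝ) * (3 * m + 1) ≤ 8 * (m * n * Real.log n) := by
    have : (n : ℝ) * (3 * m + 1) ≤ n * (4 * m) := by gcongr; linarith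
    have h2 : (m : ℝ) * n * (1 / 2) ≤ m * n * Real.log n := by gcongr
    linarith
  have h2 : 2 * (n : ℝ) * Nat.clog 2 n ≤ 8 * (m * n * Real.log n) := by
    have h3 : 2 * (n : ℝ) * Nat.clog 2 n ≤ 2 * n * (4 * Real.log n) := by gcongr
    have h4 : 1 * ((n : ℝ) * Real.log n) ≤ m * (n * Real.log n) := by gcongr
    linarith
  linarith

end Redivision

end CakeRedivision

theorem theorem4 :
    ∃ K : ℝ, 0 < K ∧ ∀ (m n : ℕ) (_ : 1 ≤ m) (hmn : m ≤ n)
      (C : CakeRedivision.Rectangle) (Z : Fin m → CakeRedivision.Rectangle),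
      CakeRedivision.IsAllocation C Z →
      ∃ (P : CakeRedivision.Protocol n (Fin n → CakeRedivision.Rectangle)) (q : ℕ),
        (q : ℝ) ≤ K * (m * n * Real.log n) ∧
        ∀ v : Fin n → CakeRedivision.Plane → ℝ,
          (∀ i, CakeRedivision.IsValueDensity C (v i)) →
          P.Achieves C v
            (fun X => CakeRedivision.IsAllocation C X ∧
              CakeRedivision.IsProportional (1 / 4) C v X ∧
              CakeRedivision.GradualRetention hmn v Z X) q := by
  refine ⟨16, by norm_num, fun m n hm hmn C Z hZ => ?_⟩
  rcases Nat.lt_or_ge 1 n with hn | hn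
  · obtain ⟨P, hP⟩ := CakeRedivision.solvable_redivision hmn (by omega) Z hZ
    exact ⟨P, _, CakeRedivision.query_bound hm hn, fun v hv => hP v hv trivial⟩
  -- Here `log n = 0` allows no query: the only agent gets all of `C`, and retention asks for `m - k
  -- = 0` indices.
  · obtain rfl : n = 1 := by omega
    obtain rfl : m = 1 := by omega
    refine ⟨.done fun _ => C, 0, by simp, fun v hv => ?_⟩
    simp only [CakeRedivision.Protocol.Achieves]
    refine ⟨⟨fun _ => subset_rfl, fun i j hij => (hij (Subsingleton.elim i j)).elim⟩,
      fun i => ?_, fun k hk _ => ⟨∅, by simp; omega, by simp⟩⟩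
    have := CakeRedivision.value_nonneg (hv i) subset_rfl C.measurableSet_coe
    push_cast
    linarith
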